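/- For $n \in \mathbb{N}$ let $\mathbb{Z}_2^n$ be the $n$-dimensional vector space over the two-element field, and let $LT(u,b)$ be the set of all linear maps $\mathbb{Z}_2^u \to \mathbb{Z}_2^b$. For $S \subseteq \mathbb{Z}_2^u$ and $T \in LT(u,b)$ let $\mathrm{lbin}(T,S) = \max_{y \in \mathbb{Z}_2^b} |T^{-1}(y) \cap S|$ be the size of a largest bin. Probabilities are with respect to the uniform random choice of $T$, and all logarithms are to the base $2$. For $0<\epsilon<1$, call a real number $c > 0$ a covering constant for $\epsilon$ if for all integers $u \ge 0$, $t \ge 1$ and all $S \subseteq \mathbb{Z}_2^u$ with $|S| \ge c\, t\, 2^t$ one has $\Pr_{T \in LT(u,t)}[T(S) = \mathbb{Z}_2^t] \ge 1 - \epsilon$. Theorem. For each $\epsilon \in (0,1)$ there exists a constant $c_\epsilon > 0$, depending only on $\epsilon$, such that for all integers $u \ge b \ge 1$, every $S \subseteq \mathbb{Z}_2^u$ with $|S| \le 2^b$, and every real $r \ge 4$, \[ \Pr_{T \in LT(u,b)}\left[\mathrm{lbin}(T,S) \ge 2 c_\epsilon r\right] \le \frac{1}{1-\epsilon}\left(\frac{\log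 r}{r}\right)^{-\log b - \log \frac{\log r}{r} + \log\log\frac{r}{\log r}}. \] Moreover, a covering constant for $\epsilon$ exists, and the bound holds with $c_\epsilon$ equal to any covering constant for $\epsilon$. -/

import Mathlib

/-- The vector space `ℤ₂ⁿ`. -/
abbrev BinVec (n : ℕ) : Type := Fin n → ZMod 2

/-- The set of all linear transformations from `ℤ₂ᵘ` to `ℤ₂ᵇ`. -/
abbrev LinMaps (u b : ℕ) : Type := BinVec u →ₗ[ZMod 2] BinVec b

instance linMapsFinite (u b : ℕ) : Finite (LinMaps u b) :=
  Finite.of_injective (fun T : LinMaps u b => (T : BinVec u → BinVec b)) DFunLike.coe_injective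

/-- The probability of the event `E` under the uniform choice of an element of the finite
nonempty set `Ω`. -/
noncomputable def unifProb {Ω : Type} [Finite Ω] [Nonempty Ω] (E : Set Ω) : ℝ :=
  (E.ncard : ℝ) / (Nat.card Ω : ℝ)

/-- The size of a largest bin created by `T` when placing `S` into `ℤ₂ᵇ`:
the maximum over all `y` in `ℤ₂ᵇ` of the number of `x ∈ S` with `T x = y`. -/
def largestBin {u b : ℕ} (T : LinMaps u b) (S : Finset (BinVec u)) : ℕ :=
  Finset.univ.sup fun y : BinVec b => (S.filter fun x => T x = y).card

/-- `c` is a covering constant for `ε`: every `S ⊆ ℤ₂ᵘ` with at least `c t 2ᵗ` elements is mapped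
onto all of `ℤ₂ᵗ` by a uniformly random linear transformation with probability at
least `1 - ε`, for all `u` and all `t ≥ 1`. -/
def IsCoveringConst (ε c : ℝ) : Prop :=
  ∀ u t : ℕ, 1 ≤ t → ∀ S : Finset (BinVec u), c * (t : ℝ) * (2 : ℝ) ^ t ≤ (S.card : ℝ) →
    1 - ε ≤ unifProb {T : LinMaps u t | T '' (S : Set (BinVec u)) = Set.univ}

/-- The tail bound for the size of a largest bin, with parameter `ε` and constant `c`, for all
placements of at most `2ᵇ` balls from `ℤ₂ᵘ` into the `2ᵇ` bins `ℤ₂ᵇ`. All logarithms are to the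
base 2. -/
def TailBound (ε c : ℝ) : Prop :=
  ∀ u b : ℕ, 1 ≤ b → b ≤ u → ∀ S : Finset (BinVec u), S.card ≤ 2 ^ b → ∀ r : ℝ, 4 ≤ r →
    unifProb {T : LinMaps u b | 2 * c * r ≤ (largestBin T S : ℝ)} ≤
      1 / (1 - ε) * (Real.logb 2 r / r) ^
        (-Real.logb 2 (b : ℝ) - Real.logb 2 (Real.logb 2 r / r)
          + Real.logb 2 (Real.logb 2 (r / Real.logb 2 r)))

open Finset

/-! Factor a uniform `T` through a larger space. Draw `Q : ℤ₂ᵘ → ℤ₂ᵗ` and `W : ℤ₂ᵗ → ℤ₂ᵇ` uniformly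
and independently, and put `P = T + W ∘ Q`. Then `P` is uniform and independent of `(Q, W)`, and `T`
is `(P, Q)` followed by the quotient map `(x, z) ↦ x - W z`.

If the bin of `T` over `y` is large, the covering property says that `Q` maps it onto `ℤ₂ᵗ` with
probability at least `1 - ε`. The image `B` of `S` under `(P, Q)` then contains the whole fiber of
the quotient over `y`. But `B` has density at most `2⁻ᵗ`, and `card_containsFiber_le` shows that a
sparse set rarely contains a fiber of a random quotient: density at most `a` gives probability at
most `a ^ (t - log b + log log (1/a))`. Comparing the two gives the tail bound, with factor `1 / (1
- ε)`.

The same lemma produces a covering constant: if `T` misses `y` on `S`, the fiber over `y` lies in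
the complement of `B`, and a second moment estimate makes that complement sparse on average when `S`
is large. -/

/-! ### Elementary inequalities for the induction -/

theorem le_mul_logb_of_one_le {l m : ℝ} (hl : 1 ≤ l) (hm : m ≤ 2) (hml : m ≤ l) :
    m * (l - 1) ≤ l * Real.logb 2 l := by
  have hlog2 : 0 < Real.log 2 := Real.log_pos one_lt_two
  have hlog2' : Real.log 2 ≤ 1 := by linarith [Real.log_two_lt_d9]
  have key : ∀ x : ℝ, 0 < x → x ≤ 1 → Real.logb 2 x ≤ x - 1 := by
    intro x hx hx1
    rw [Real.logb, div_le_iff₀ hlog2]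
    have h1 := Real.log_le_sub_one_of_pos hx
    nlinarith
  rcases le_total l 2 with h2 | h2
  · have hc : l - 1 ≤ Real.logb 2 l := by
      have hconc := strictConcaveOn_log_Ioi.concaveOn.2 (Set.mem_Ioi.2 one_pos)
        (Set.mem_Ioi.2 (two_pos : (0 : ℝ) < 2)) (by linarith : 0 ≤ 2 - l)
        (by linarith : 0 ≤ l - 1) (by ring)
      simp only [smul_eq_mul, Real.log_one, mul_zero, zero_add] at hconc
      rw [Real.logb, le_div_iff₀ hlog2]
      convert hconc using 2
      ring
    nlinarith
  · have hl0 : 0 < l := by linarith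
    have h := key (2 / l) (by positivity) ((div_le_one hl0).2 h2)
    rw [Real.logb_div two_ne_zero hl0.ne', Real.logb_self_eq_one one_lt_two] at h
    have h3 : l * (2 - 2 / l) ≤ l * Real.logb 2 l := by gcongr; linarith
    have h4 : l * (2 - 2 / l) = 2 * (l - 1) := by field_simp
    nlinarith

/-- Replaces a power of `x` by a bound linear in `x`, so that only the mean of `x` matters in the
induction. With `g = -logb 2 a`, `l = logb 2 x / logb 2 a` and `k = e + 1 + logb 2 g`, the right
side is at least `1` when `l ≤ 2 - k`; otherwise the claim reduces to `(2 - k) * (l - 1) ≤ l * logb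
2 l`. -/
theorem min_one_rpow_le {a x e : ℝ} (ha : a < 1) (hx : 0 < x) (hxa : x ≤ a)
    (hk : 0 ≤ e + 1 + Real.logb 2 (-Real.logb 2 a)) :
    min 1 (x ^ (e + Real.logb 2 (-Real.logb 2 x))) ≤
      a ^ (e + 1 + Real.logb 2 (-Real.logb 2 a) - 2) * x := by
  have ha0 : 0 < a := hx.trans_le hxa
  obtain ⟨g, hg⟩ : ∃ g, g = -Real.logb 2 a := ⟨_, rfl⟩
  obtain ⟨g', hg'⟩ : ∃ g', g' = -Real.logb 2 x := ⟨_, rfl⟩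
  have hg0 : 0 < g := by rw [hg]; linarith [Real.logb_neg one_lt_two ha0 ha]
  have hgg : g ≤ g' := by
    rw [hg, hg']; linarith [Real.logb_le_logb_of_le one_lt_two hx hxa]
  have ha2 : a = 2 ^ (-g) := by
    rw [hg, neg_neg, Real.rpow_logb two_pos (by norm_num) ha0]
  have hx2 : x = 2 ^ (-g') := by
    rw [hg', neg_neg, Real.rpow_logb two_pos (by norm_num) hx]
  rw [← hg] at hk ⊢
  rw [← hg']
  obtain ⟨l, hl⟩ : ∃ l, l = g' / g := ⟨_, rfl⟩
  have hl1 : 1 ≤ l := by rw [hl]; exact (one_le_div hg0).2 hgg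
  have hg'l : g' = l * g := by rw [hl]; field_simp
  have hlog : Real.logb 2 g' = Real.logb 2 l + Real.logb 2 g := by
    rw [hg'l, Real.logb_mul (by linarith) hg0.ne']
  rw [hlog, ha2, hx2, ← Real.rpow_mul two_pos.le, ← Real.rpow_mul two_pos.le,
    ← Real.rpow_add two_pos]
  obtain ⟨k, hkk⟩ : ∃ k, k = e + 1 + Real.logb 2 g := ⟨_, rfl⟩
  rw [← hkk] at hk ⊢
  rcases le_total l (2 - k) with h | h
  · refine (min_le_left _ _).trans (Real.one_le_rpow one_le_two ?_)
    rw [hg'l]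
    nlinarith
  · refine (min_le_right _ _).trans ((Real.rpow_le_rpow_left_iff one_lt_two).2 ?_)
    have h1 := le_mul_logb_of_one_le hl1 (by linarith : 2 - k ≤ 2) h
    have h2 : e + (Real.logb 2 l + Real.logb 2 g) = k - 1 + Real.logb 2 l := by
      rw [hkk]; ring
    rw [h2, hg'l]
    nlinarith [mul_le_mul_of_nonneg_left h1 hg0.le]

/-! ### Sparse sets rarely contain a fiber of a random quotient -/

/-- The linear map `ℤ₂ᵗ → ℤ₂ᵇ` with columns `W`. -/
noncomputable def ofColumns {t b : ℕ} (W : Fin t → BinVec b) : LinMaps t b :=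
  Fintype.linearCombination (ZMod 2) W

theorem ofColumns_cons {t b : ℕ} (w : BinVec b) (W : Fin t → BinVec b) (e : ZMod 2)
    (z : BinVec t) :
    ofColumns (Fin.cons w W : Fin (t + 1) → BinVec b) (Fin.cons e z : Fin (t + 1) → ZMod 2) =
      e • w + ofColumns W z := by
  simp [ofColumns, Fintype.linearCombination_apply, Fin.sum_univ_succ]

/-- `B` contains a fiber of the surjection `(x, z) ↦ x - W z`. -/
def ContainsFiber {t b : ℕ} (W : Fin t → BinVec b) (B : Finset (BinVec b × BinVec t)) : Prop :=
  ∃ y, ∀ z, (y + ofColumns W z, z) ∈ B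

/-- The preimage of `B` under `z ↦ (y, (e, z))`. -/
def headSlice {t b : ℕ} (e : ZMod 2) (B : Finset (BinVec b × BinVec (t + 1))) :
    Finset (BinVec b × BinVec t) :=
  univ.filter fun p => (p.1, (Fin.cons e p.2 : Fin (t + 1) → ZMod 2)) ∈ B

/-- The points whose whole fiber under the quotient by `(v, 1)` lies in `B`. -/
def quotientBy {t b : ℕ} (v : BinVec b × BinVec t) (B : Finset (BinVec b × BinVec (t + 1))) :
    Finset (BinVec b × BinVec t) :=
  univ.filter fun p => p ∈ headSlice 0 B ∧ p + v ∈ headSlice 1 B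

theorem binVec_cons_inj {t : ℕ} {e e' : ZMod 2} {z z' : BinVec t} :
    (Fin.cons e z : Fin (t + 1) → ZMod 2) = (Fin.cons e' z' : Fin (t + 1) → ZMod 2) ↔
      e = e' ∧ z = z' :=
  Fin.cons_inj

theorem card_headSlice_add_card_headSlice {t b : ℕ} (B : Finset (BinVec b × BinVec (t + 1))) :
    (headSlice 0 B).card + (headSlice 1 B).card = B.card := by
  have h : B = (headSlice 0 B).image (fun p => (p.1, (Fin.cons 0 p.2 : Fin (t + 1) → ZMod 2))) ∪
      (headSlice 1 B).image (fun p => (p.1, (Fin.cons 1 p.2 : Fin (t + 1) → ZMod 2))) := by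
    ext ⟨y, z⟩
    obtain ⟨e, z, rfl⟩ : ∃ (e : ZMod 2) (z' : BinVec t),
        z = (Fin.cons e z' : Fin (t + 1) → ZMod 2) := ⟨z 0, Fin.tail z, (Fin.cons_self_tail z).symm⟩
    simp only [mem_union, mem_image, headSlice, mem_filter, mem_univ, true_and]
    constructor
    · intro h
      obtain rfl | rfl : e = 0 ∨ e = 1 := (by decide : ∀ e : ZMod 2, e = 0 ∨ e = 1) e
      · exact Or.inl ⟨(y, z), h, rfl⟩
      · exact Or.inr ⟨(y, z), h, rfl⟩
    · rintro (⟨p, hp, h⟩ | ⟨p, hp, h⟩) <;> exact h ▸ hp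
  conv_rhs => rw [h]
  rw [card_union_of_disjoint, card_image_of_injective, card_image_of_injective]
  · intro p q hpq; simpa [Prod.ext_iff, binVec_cons_inj] using hpq
  · intro p q hpq; simpa [Prod.ext_iff, binVec_cons_inj] using hpq
  · rw [disjoint_left]
    intro x hx hx'
    obtain ⟨p, -, rfl⟩ := mem_image.1 hx
    obtain ⟨q, -, hq⟩ := mem_image.1 hx'
    simp at hq

theorem sum_card_quotientBy {t b : ℕ} (B : Finset (BinVec b × BinVec (t + 1))) :
    ∑ v, (quotientBy v B).card = (headSlice 0 B).card * (headSlice 1 B).card := by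
  simp_rw [quotientBy, card_filter]
  rw [sum_comm]
  have h : ∀ p : BinVec b × BinVec t,
      (∑ v, if p ∈ headSlice 0 B ∧ p + v ∈ headSlice 1 B then 1 else 0) =
        if p ∈ headSlice 0 B then (headSlice 1 B).card else 0 := by
    intro p
    by_cases hp : p ∈ headSlice 0 B
    · simp only [hp, true_and, if_true]
      refine (Fintype.sum_equiv (Equiv.addLeft p) _
        (fun v => if v ∈ headSlice 1 B then 1 else 0) (fun v => rfl)).trans ?_
      simp
    · simp [hp]
  simp_rw [h]
  simp

theorem card_quotientBy_le_left {t b : ℕ} (v : BinVec b × BinVec t)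
    (B : Finset (BinVec b × BinVec (t + 1))) : (quotientBy v B).card ≤ (headSlice 0 B).card :=
  card_le_card fun p hp => (by simpa [quotientBy] using hp : _ ∧ _).1

theorem card_quotientBy_le_right {t b : ℕ} (v : BinVec b × BinVec t)
    (B : Finset (BinVec b × BinVec (t + 1))) : (quotientBy v B).card ≤ (headSlice 1 B).card :=
  card_le_card_of_injOn (· + v) (fun p hp => (by simpa [quotientBy] using hp : _ ∧ _).2)
    (add_left_injective v).injOn

theorem ContainsFiber.quotientBy {t b : ℕ} {W : Fin t → BinVec b} {w : BinVec b} {w' : BinVec t}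
    {B : Finset (BinVec b × BinVec (t + 1))}
    (h : ContainsFiber (Fin.cons (w - ofColumns W w') W : Fin (t + 1) → BinVec b) B) :
    ContainsFiber W (quotientBy (w, w') B) := by
  obtain ⟨y, hy⟩ := h
  refine ⟨y, fun z => ?_⟩
  have h0 := hy (Fin.cons 0 z : Fin (t + 1) → ZMod 2)
  have h1 := hy (Fin.cons 1 (z + w') : Fin (t + 1) → ZMod 2)
  rw [ofColumns_cons] at h0 h1
  simp only [_root_.quotientBy, headSlice, mem_filter, mem_univ, true_and, Prod.mk_add_mk]
  refine ⟨by simpa using h0, ?_⟩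
  convert h1 using 2
  rw [map_add, one_smul]
  abel

open Classical in
-- The quotient is taken one dimension at a time. For each fixed `w'`, writing the first column as
-- `w - W w'` is a bijective change of variable, and a fiber in `B` then descends to one in the
-- quotient by `(w, w')`. Summing over `w'` makes the direction `(w, w')` range over the whole
-- space, independently of `W`.
theorem two_pow_mul_card_containsFiber_le {t b : ℕ} (B : Finset (BinVec b × BinVec (t + 1))) :
    2 ^ t * (univ.filter fun W : Fin (t + 1) → BinVec b => ContainsFiber W B).card ≤
      ∑ v : BinVec b × BinVec t,
        (univ.filter fun W : Fin t → BinVec b => ContainsFiber W (quotientBy v B)).card := by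
  have h1 : ∀ w' : BinVec t,
      (univ.filter fun W : Fin (t + 1) → BinVec b => ContainsFiber W B).card ≤
        ∑ w : BinVec b, (univ.filter fun W : Fin t → BinVec b =>
          ContainsFiber W (quotientBy (w, w') B)).card := by
    intro w'
    simp_rw [card_filter]
    rw [← (Fin.consEquiv (fun _ : Fin (t + 1) => BinVec b)).sum_comp, Fintype.sum_prod_type,
      sum_comm, sum_comm (s := univ) (t := univ) (f := fun (w : BinVec b) (W : Fin t → BinVec b) =>
        if ContainsFiber W (quotientBy (w, w') B) then 1 else 0)]
    refine sum_le_sum fun W _ => ?_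
    rw [← (Equiv.subRight (ofColumns W w')).sum_comp]
    refine sum_le_sum fun w _ => ?_
    simp only [Equiv.subRight_apply]
    split_ifs with ha hb
    · exact le_rfl
    · exact absurd ha.quotientBy hb
    · exact Nat.zero_le _
    · exact le_rfl
  rw [Fintype.sum_prod_type, sum_comm]
  calc _ = ∑ _w' : BinVec t,
        (univ.filter fun W : Fin (t + 1) → BinVec b => ContainsFiber W B).card := by
        simp [ZMod.card]
    _ ≤ _ := sum_le_sum fun w' _ => h1 w'

open Classical in
-- Induction on `t`. Quotienting by a random direction leaves a set whose density never exceeds the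
-- smaller of the two half densities, hence is at most `a`, and whose mean density is their product,
-- at most `a ^ 2` by AM-GM.
theorem card_containsFiber_le {b : ℕ} (hb : 1 ≤ b) (t : ℕ) :
    ∀ (B : Finset (BinVec b × BinVec t)) (a : ℝ), 0 < a → a < 1 →
      (B.card : ℝ) ≤ a * 2 ^ (b + t) →
      ((univ.filter fun W : Fin t → BinVec b => ContainsFiber W B).card : ℝ) ≤
        2 ^ (b * t) * a ^ ((t : ℝ) - Real.logb 2 b + Real.logb 2 (-Real.logb 2 a)) := by
  induction t with
  | zero =>
    intro B a ha ha1 hB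
    have hb0 : (0 : ℝ) < b := by exact_mod_cast hb
    have hg0 : 0 < -Real.logb 2 a := by linarith [Real.logb_neg one_lt_two ha ha1]
    rcases B.eq_empty_or_nonempty with rfl | hne
    · have : ∀ W : Fin 0 → BinVec b, ¬ ContainsFiber W (∅ : Finset (BinVec b × BinVec 0)) := by
        rintro W ⟨y, hy⟩; simpa using hy 0
      simp only [this, filter_false, card_empty, Nat.cast_zero]
      positivity
    · have h1 : (1 : ℝ) ≤ a * 2 ^ b := by
        refine le_trans ?_ hB
        exact_mod_cast hne.card_pos
      have h2 : -Real.logb 2 a ≤ b := by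
        have := Real.logb_le_logb_of_le one_lt_two one_pos h1
        rw [Real.logb_one, Real.logb_mul ha.ne' (by positivity), Real.logb_pow,
          Real.logb_self_eq_one one_lt_two] at this
        linarith
      have h3 : Real.logb 2 (-Real.logb 2 a) ≤ Real.logb 2 b :=
        Real.logb_le_logb_of_le one_lt_two hg0 h2
      have h4 : (1 : ℝ) ≤ a ^ (((0 : ℕ) : ℝ) - Real.logb 2 b + Real.logb 2 (-Real.logb 2 a)) :=
        Real.one_le_rpow_of_pos_of_le_one_of_nonpos ha ha1.le (by push_cast; linarith)
      refine le_trans ?_ (le_of_le_of_eq h4 (by simp))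
      exact_mod_cast (card_le_univ _).trans (by simp)
  | succ t ih =>
    intro B a ha ha1 hB
    obtain ⟨k, hk⟩ : ∃ k, k = (t : ℝ) - Real.logb 2 b + 1 + Real.logb 2 (-Real.logb 2 a) :=
      ⟨_, rfl⟩
    have hk' : ((t + 1 : ℕ) : ℝ) - Real.logb 2 b + Real.logb 2 (-Real.logb 2 a) = k := by
      rw [hk]; push_cast; ring
    rw [hk']
    have htriv : ∀ (m : ℕ) (A : Finset (Fin m → BinVec b)), (A.card : ℝ) ≤ 2 ^ (b * m) := by
      intro m A
      have := card_le_univ A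
      rw [Fintype.card_fun, Fintype.card_fun, ZMod.card, Fintype.card_fin, Fintype.card_fin,
        ← pow_mul] at this
      exact_mod_cast this
    rcases lt_or_ge k 0 with hk0 | hk0
    · refine (htriv _ _).trans (le_mul_of_one_le_right (by positivity) ?_)
      exact Real.one_le_rpow_of_pos_of_le_one_of_nonpos ha ha1.le hk0.le
    have hS := card_headSlice_add_card_headSlice B
    have hS' : ((headSlice 0 B).card : ℝ) + (headSlice 1 B).card ≤ 2 * (a * 2 ^ (b + t)) := by
      rw [← Nat.cast_add, hS]
      calc _ ≤ _ := hB
        _ = _ := by ring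
    have hN : (0 : ℝ) < 2 ^ (b + t) := by positivity
    have hterm : ∀ v : BinVec b × BinVec t,
        ((univ.filter fun W : Fin t → BinVec b => ContainsFiber W (quotientBy v B)).card : ℝ) ≤
          2 ^ (b * t) * (a ^ (k - 2) * ((quotientBy v B).card / 2 ^ (b + t))) := by
      intro v
      rcases (quotientBy v B).eq_empty_or_nonempty with h0 | hne
      · have : ∀ W : Fin t → BinVec b, ¬ ContainsFiber W (∅ : Finset (BinVec b × BinVec t)) := by
          rintro W ⟨y, hy⟩; simpa using hy 0
        simp [h0, this]
      · have hx : 0 < ((quotientBy v B).card : ℝ) / 2 ^ (b + t) :=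
          div_pos (by exact_mod_cast hne.card_pos) hN
        have hxa : ((quotientBy v B).card : ℝ) / 2 ^ (b + t) ≤ a := by
          rw [div_le_iff₀ hN]
          have h1 : ((quotientBy v B).card : ℝ) ≤ (headSlice 0 B).card := by
            exact_mod_cast card_quotientBy_le_left v B
          have h2 : ((quotientBy v B).card : ℝ) ≤ (headSlice 1 B).card := by
            exact_mod_cast card_quotientBy_le_right v B
          linarith
        have hm := min_one_rpow_le (e := (t : ℝ) - Real.logb 2 b) ha1 hx hxa (hk ▸ hk0)
        rw [← hk] at hm
        refine le_trans ?_ (mul_le_mul_of_nonneg_left hm (by positivity))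
        rw [mul_min_of_nonneg _ _ (by positivity), mul_one]
        exact le_min (htriv _ _)
          (ih _ _ hx (hxa.trans_lt ha1) (by rw [div_mul_cancel₀ _ hN.ne']))
    have hcount : (2 : ℝ) ^ t *
        (univ.filter fun W : Fin (t + 1) → BinVec b => ContainsFiber W B).card ≤
          ∑ v : BinVec b × BinVec t,
            ((univ.filter fun W : Fin t → BinVec b =>
              ContainsFiber W (quotientBy v B)).card : ℝ) := by
      exact_mod_cast two_pow_mul_card_containsFiber_le B
    have hprod : (∑ v, ((quotientBy v B).card : ℝ)) ≤ (a * 2 ^ (b + t)) ^ 2 := by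
      have := sum_card_quotientBy B
      have h' : (∑ v, ((quotientBy v B).card : ℝ)) = (headSlice 0 B).card * (headSlice 1 B).card := by
        exact_mod_cast this
      rw [h']
      have hs0 : (0 : ℝ) ≤ (headSlice 0 B).card := Nat.cast_nonneg _
      have hs1 : (0 : ℝ) ≤ (headSlice 1 B).card := Nat.cast_nonneg _
      nlinarith [sq_nonneg (((headSlice 0 B).card : ℝ) - (headSlice 1 B).card)]
    have hak : a ^ (k - 2) * a ^ 2 = a ^ k := by
      rw [← Real.rpow_natCast a 2, ← Real.rpow_add ha]; congr 1; push_cast; ring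
    have h2t : (0 : ℝ) < 2 ^ t := by positivity
    refine le_of_mul_le_mul_left ?_ h2t
    calc _ ≤ _ := hcount
      _ ≤ ∑ v, 2 ^ (b * t) * (a ^ (k - 2) * (((quotientBy v B).card : ℝ) / 2 ^ (b + t))) :=
        sum_le_sum fun v _ => hterm v
      _ = 2 ^ (b * t) * a ^ (k - 2) * (∑ v, ((quotientBy v B).card : ℝ)) / 2 ^ (b + t) := by
        rw [mul_sum, sum_div]
        exact sum_congr rfl fun v _ => by ring
      _ ≤ 2 ^ (b * t) * a ^ (k - 2) * (a * 2 ^ (b + t)) ^ 2 / 2 ^ (b + t) := by gcongr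
      _ = 2 ^ (b * t) * (a ^ (k - 2) * a ^ 2) * 2 ^ (b + t) := by field_simp
      _ = _ := by rw [hak]; ring

/-! ### From large bins to fibers: the tail bound -/

noncomputable instance linMapsFintype (u b : ℕ) : Fintype (LinMaps u b) := Fintype.ofFinite _

theorem unifProb_eq {Ω : Type} [Fintype Ω] [Nonempty Ω] (E : Set Ω) [DecidablePred (· ∈ E)] :
    unifProb E = ((univ.filter fun x => x ∈ E).card : ℝ) / Fintype.card Ω := by
  rw [unifProb, Nat.card_eq_fintype_card, ← Set.ncard_coe_finset]
  simp

/-- The image of `S` under `x ↦ (P x, Q x)`. -/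
def pairImage {u b t : ℕ} (P : LinMaps u b) (Q : LinMaps u t) (S : Finset (BinVec u)) :
    Finset (BinVec b × BinVec t) :=
  S.image fun x => (P x, Q x)

theorem card_columns (t b : ℕ) : (Fintype.card (Fin t → BinVec b) : ℝ) = 2 ^ (b * t) := by
  rw [Fintype.card_fun, Fintype.card_fun, ZMod.card, Fintype.card_fin, Fintype.card_fin,
    ← pow_mul]
  norm_cast

theorem card_binVec_prod (t b : ℕ) : (Fintype.card (BinVec b × BinVec t) : ℝ) = 2 ^ (b + t) := by
  rw [Fintype.card_prod, Fintype.card_fun, Fintype.card_fun, ZMod.card, Fintype.card_fin,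
    Fintype.card_fin, ← pow_add]
  norm_cast

theorem sum_comp_add_ofColumns {u b t : ℕ}
    (f : LinMaps u b → LinMaps u t → (Fin t → BinVec b) → ℕ) :
    ∑ T, ∑ Q, ∑ W, f (T + (ofColumns W).comp Q) Q W = ∑ P, ∑ Q, ∑ W, f P Q W := by
  rw [sum_comm, sum_comm (f := fun P Q => ∑ W, f P Q W)]
  refine sum_congr rfl fun Q _ => ?_
  rw [sum_comm, sum_comm (f := fun P W => f P Q W)]
  refine sum_congr rfl fun W _ => ?_
  exact Equiv.sum_comp (Equiv.addRight ((ofColumns W).comp Q)) fun P => f P Q W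

theorem containsFiber_pairImage {u b t : ℕ} (T : LinMaps u b) (Q : LinMaps u t)
    (W : Fin t → BinVec b) (S : Finset (BinVec u)) (y : BinVec b)
    (h : Q '' (S.filter fun x => T x = y : Finset (BinVec u)) = Set.univ) :
    ContainsFiber W (pairImage (T + (ofColumns W).comp Q) Q S) := by
  refine ⟨y, fun z => ?_⟩
  obtain ⟨x, hx, rfl⟩ : z ∈ Q '' (S.filter fun x => T x = y : Finset (BinVec u)) := h ▸ trivial
  obtain ⟨hxS, hxy⟩ := mem_filter.1 (mem_coe.1 hx)
  exact mem_image.2 ⟨x, hxS, by simp [hxy]⟩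

theorem containsFiber_compl_pairImage {u b t : ℕ} (T : LinMaps u b) (Q : LinMaps u t)
    (W : Fin t → BinVec b) (S : Finset (BinVec u))
    (h : T '' (S : Set (BinVec u)) ≠ Set.univ) :
    ContainsFiber W (pairImage (T + (ofColumns W).comp Q) Q S)ᶜ := by
  obtain ⟨y, hy⟩ := (Set.ne_univ_iff_exists_notMem _).1 h
  refine ⟨y, fun z => ?_⟩
  rw [mem_compl]
  intro hz
  obtain ⟨x, hxS, hx⟩ := mem_image.1 hz
  obtain ⟨h1, rfl⟩ := Prod.mk.inj hx
  exact hy ⟨x, hxS, by simpa using h1⟩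

theorem exists_largestBin_eq_card {u b : ℕ} (T : LinMaps u b) (S : Finset (BinVec u)) :
    ∃ y, largestBin T S = (S.filter fun x => T x = y).card := by
  obtain ⟨y, -, hy⟩ := exists_mem_eq_sup (univ : Finset (BinVec b)) univ_nonempty
    fun y => (S.filter fun x => T x = y).card
  exact ⟨y, hy⟩

open Classical in
theorem sum_sum_sum_containsFiber {u b t : ℕ}
    (g : LinMaps u b → LinMaps u t → Finset (BinVec b × BinVec t)) :
    ∑ T, ∑ Q, (univ.filter fun W : Fin t → BinVec b =>
        ContainsFiber W (g (T + (ofColumns W).comp Q) Q)).card =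
      ∑ P, ∑ Q, (univ.filter fun W : Fin t → BinVec b => ContainsFiber W (g P Q)).card := by
  simp_rw [card_filter]
  exact sum_comp_add_ofColumns fun P Q W => if ContainsFiber W (g P Q) then 1 else 0

theorem unifProb_largestBin_le {ε c : ℝ} (hε1 : ε < 1) (hcov : IsCoveringConst ε c)
    {u b t : ℕ} (hb : 1 ≤ b) (ht : 1 ≤ t) (S : Finset (BinVec u)) (hS : S.card ≤ 2 ^ b)
    {m a : ℝ} (hm : c * t * 2 ^ t ≤ m) (ha0 : 0 < a) (ha1 : a < 1) (ha : 1 ≤ a * 2 ^ t) :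
    unifProb {T : LinMaps u b | m ≤ (largestBin T S : ℝ)} ≤
      1 / (1 - ε) * a ^ ((t : ℝ) - Real.logb 2 b + Real.logb 2 (-Real.logb 2 a)) := by
  classical
  have hε : 0 < 1 - ε := by linarith
  obtain ⟨p, hp⟩ : ∃ p, p = a ^ ((t : ℝ) - Real.logb 2 b + Real.logb 2 (-Real.logb 2 a)) :=
    ⟨_, rfl⟩
  rw [← hp, unifProb_eq]
  have hL : (0 : ℝ) < Fintype.card (LinMaps u b) := by exact_mod_cast Fintype.card_pos
  have hM : (0 : ℝ) < Fintype.card (LinMaps u t) := by exact_mod_cast Fintype.card_pos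
  rw [div_le_iff₀ hL, one_div, mul_assoc, ← div_eq_inv_mul, le_div_iff₀ hε]
  have hW : (0 : ℝ) < 2 ^ (b * t) := by positivity
  -- The covering property is applied to a heaviest bin; each `Q` covering with it contributes every
  -- `W`.
  have hlower : ∀ T : LinMaps u b, m ≤ (largestBin T S : ℝ) →
      (1 - ε) * Fintype.card (LinMaps u t) * 2 ^ (b * t) ≤
        ∑ Q : LinMaps u t, ((univ.filter fun W : Fin t → BinVec b =>
          ContainsFiber W (pairImage (T + (ofColumns W).comp Q) Q S)).card : ℝ) := by
    intro T hT
    obtain ⟨y, hy⟩ := exists_largestBin_eq_card T S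
    have h := hcov u t ht (S.filter fun x => T x = y) (by rw [← hy]; exact hm.trans hT)
    rw [unifProb_eq, le_div_iff₀ hM] at h
    refine (mul_le_mul_of_nonneg_right h hW.le).trans ?_
    rw [card_filter, Nat.cast_sum, sum_mul]
    refine sum_le_sum fun Q _ => ?_
    split_ifs with hQ
    · have : (univ.filter fun W : Fin t → BinVec b =>
          ContainsFiber W (pairImage (T + (ofColumns W).comp Q) Q S)) = univ :=
        filter_true_of_mem fun W _ => containsFiber_pairImage T Q W S y hQ
      rw [this, card_univ, card_columns]
      simp
    · simp
  have hcard : ∀ (P : LinMaps u b) (Q : LinMaps u t),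
      ((pairImage P Q S).card : ℝ) ≤ a * 2 ^ (b + t) := by
    intro P Q
    have h1 : ((pairImage P Q S).card : ℝ) ≤ 2 ^ b := by exact_mod_cast card_image_le.trans hS
    rw [pow_add]
    nlinarith [mul_le_mul_of_nonneg_right ha (by positivity : (0 : ℝ) ≤ 2 ^ b)]
  have hupper : (∑ T : LinMaps u b, ∑ Q : LinMaps u t, ((univ.filter fun W : Fin t → BinVec b =>
      ContainsFiber W (pairImage (T + (ofColumns W).comp Q) Q S)).card : ℝ)) ≤
      Fintype.card (LinMaps u b) * (Fintype.card (LinMaps u t) * (2 ^ (b * t) * p)) := by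
    have h := sum_sum_sum_containsFiber (fun (P : LinMaps u b) (Q : LinMaps u t) =>
      pairImage P Q S)
    have h' : (∑ T : LinMaps u b, ∑ Q : LinMaps u t, ((univ.filter fun W : Fin t → BinVec b =>
        ContainsFiber W (pairImage (T + (ofColumns W).comp Q) Q S)).card : ℝ)) =
        ∑ P : LinMaps u b, ∑ Q : LinMaps u t, ((univ.filter fun W : Fin t → BinVec b =>
          ContainsFiber W (pairImage P Q S)).card : ℝ) := by exact_mod_cast h
    rw [h']
    calc _ ≤ ∑ _P : LinMaps u b, ∑ _Q : LinMaps u t, 2 ^ (b * t) * p :=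
          sum_le_sum fun P _ => sum_le_sum fun Q _ =>
            hp ▸ card_containsFiber_le hb t _ a ha0 ha1 (hcard P Q)
      _ = _ := by simp [card_univ]
  have hmain : ((univ.filter fun T => T ∈ {T : LinMaps u b | m ≤ (largestBin T S : ℝ)}).card : ℝ) *
      ((1 - ε) * Fintype.card (LinMaps u t) * 2 ^ (b * t)) ≤
      Fintype.card (LinMaps u b) * (Fintype.card (LinMaps u t) * (2 ^ (b * t) * p)) := by
    refine le_trans ?_ hupper
    rw [← nsmul_eq_mul, ← sum_const]
    refine (sum_le_sum fun T hT => hlower T (mem_filter.1 hT).2).trans ?_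
    exact sum_le_sum_of_subset_of_nonneg (subset_univ _) fun T _ _ =>
      sum_nonneg fun Q _ => Nat.cast_nonneg _
  refine le_of_mul_le_mul_right ?_ (mul_pos hM hW)
  linarith

theorem tailBound_of_isCoveringConst {ε c : ℝ} (hε1 : ε < 1) (hc : 0 < c)
    (hcov : IsCoveringConst ε c) : TailBound ε c := by
  intro u b hb _ S hS r hr
  have hr0 : 0 < r := by linarith
  obtain ⟨l, hl⟩ : ∃ l, l = Real.logb 2 r := ⟨_, rfl⟩
  have hlog4 : Real.logb 2 4 = 2 := by
    rw [show (4 : ℝ) = 2 ^ 2 by norm_num, Real.logb_pow, Real.logb_self_eq_one one_lt_two]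
    norm_num
  have hl2 : 2 ≤ l := by
    rw [hl]; exact hlog4.symm.le.trans (Real.logb_le_logb_of_le one_lt_two (by norm_num) hr)
  have hl0 : 0 < l := by linarith
  have hll : 1 ≤ Real.logb 2 l := by
    rw [← Real.logb_self_eq_one one_lt_two]
    exact Real.logb_le_logb_of_le one_lt_two two_pos hl2
  have hr2 : r = 2 ^ l := by rw [hl, Real.rpow_logb two_pos (by norm_num) hr0]
  have hbern : 2 * l ≤ r := by
    have h := one_add_mul_self_le_rpow_one_add (by norm_num : (-1 : ℝ) ≤ 1)
      (by linarith : (1 : ℝ) ≤ l - 1)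
    rw [show (1 : ℝ) + 1 = 2 by norm_num, Real.rpow_sub_one two_ne_zero, ← hr2] at h
    linarith
  rw [← hl]
  obtain ⟨a, ha⟩ : ∃ a, a = l / r := ⟨_, rfl⟩
  have ha0 : 0 < a := by rw [ha]; positivity
  have ha2 : a ≤ 1 / 2 := by rw [ha, div_le_iff₀ hr0]; linarith
  have hga : -Real.logb 2 a = l - Real.logb 2 l := by
    rw [ha, Real.logb_div hl0.ne' hr0.ne', ← hl]; ring
  have hinv : Real.logb 2 (r / l) = -Real.logb 2 a := by
    rw [ha, ← Real.logb_inv, inv_div]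
  have hg1 : 1 ≤ -Real.logb 2 a := by
    have := Real.logb_le_logb_of_le one_lt_two ha0 ha2
    rw [one_div, Real.logb_inv, Real.logb_self_eq_one one_lt_two] at this
    linarith
  rw [hinv, ← ha]
  -- The least `t` with `2⁻ᵗ ≤ a`; rounding up costs the factor `2` in `2 * c * r`.
  obtain ⟨t, ht⟩ : ∃ t, t = ⌈-Real.logb 2 a⌉₊ := ⟨_, rfl⟩
  have hgt : -Real.logb 2 a ≤ t := by rw [ht]; exact Nat.le_ceil _
  have htg : (t : ℝ) < -Real.logb 2 a + 1 := by rw [ht]; exact Nat.ceil_lt_add_one (by linarith)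
  have ht1 : 1 ≤ t := by
    have : (1 : ℝ) ≤ t := hg1.trans hgt
    exact_mod_cast this
  have hpow : (2 : ℝ) ^ (-Real.logb 2 a) = a⁻¹ := by
    rw [← Real.logb_inv, Real.rpow_logb two_pos (by norm_num) (by positivity)]
  have h1 : 1 ≤ a * 2 ^ t := by
    rw [← Real.rpow_natCast, ← div_le_iff₀' ha0, one_div, ← hpow]
    exact Real.rpow_le_rpow_of_exponent_le one_le_two hgt
  have h2 : (2 : ℝ) ^ t ≤ 2 * (r / l) := by
    have h := Real.rpow_le_rpow_of_exponent_le one_le_two htg.le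
    rw [Real.rpow_natCast, Real.rpow_add_one two_ne_zero, hpow, ha, inv_div] at h
    linarith
  have hm : c * t * 2 ^ t ≤ 2 * c * r := by
    -- The `+ 1` from rounding is absorbed by `logb 2 l ≥ 1`, which comes from `r ≥ 4`.
    have htl : (t : ℝ) ≤ l := by linarith
    calc c * t * 2 ^ t ≤ c * l * (2 * (r / l)) := by gcongr
      _ = 2 * c * r := by field_simp
  refine (unifProb_largestBin_le hε1 hcov hb ht1 S hS hm ha0 (by linarith) h1).trans ?_
  refine mul_le_mul_of_nonneg_left ?_ (one_div_nonneg.2 (by linarith))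
  exact Real.rpow_le_rpow_of_exponent_ge ha0 (by linarith) (by linarith)

/-! ### Existence of a covering constant -/

theorem card_annihilator_mul {u b : ℕ} {z : BinVec u} (hz : z ≠ 0) :
    (univ.filter fun P : LinMaps u b => P z = 0).card * 2 ^ b = Fintype.card (LinMaps u b) := by
  obtain ⟨i, hi⟩ := Function.ne_iff.1 hz
  have hi1 : z i = 1 := ((by decide : ∀ e : ZMod 2, e ≠ 0 → e = 1) _) hi
  have hfib : ∀ y : BinVec b, (univ.filter fun P : LinMaps u b => P z = y).card =
      (univ.filter fun P : LinMaps u b => P z = 0).card := by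
    intro y
    let R : LinMaps u b := (LinearMap.proj i : BinVec u →ₗ[ZMod 2] ZMod 2).smulRight y
    have hR : R z = y := by simp [R, hi1]
    refine card_bij' (fun P _ => P - R) (fun P _ => P + R) ?_ ?_ ?_ ?_
    · intro P hP; simpa [hR, sub_eq_zero] using hP
    · intro P hP; simpa [hR] using hP
    · exact fun P _ => sub_add_cancel P R
    · exact fun P _ => add_sub_cancel_right P R
  rw [← card_univ, card_eq_sum_card_fiberwise (s := univ) (f := fun P : LinMaps u b => P z)
    (t := (univ : Finset (BinVec b))) (fun _ _ => mem_coe.2 (mem_univ _))]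
  refine Eq.trans ?_ (sum_congr rfl fun y _ => hfib y).symm
  simp [ZMod.card, mul_comm]

/-- Chebyshev: with `k y` the load of `y`, each missed `y` contributes `n ^ 2` to `∑ y, (N * k y -
n) ^ 2`, and `∑ y, k y ^ 2` counts collisions. -/
theorem card_compl_image_mul_sq_le {X Y : Type*} [Fintype Y] [DecidableEq Y] (f : X → Y)
    (S : Finset X) :
    ((S.image f)ᶜ.card : ℝ) * (S.card : ℝ) ^ 2 ≤
      (Fintype.card Y : ℝ) ^ 2 * ∑ x ∈ S, ∑ x' ∈ S, (if f x = f x' then 1 else 0) -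
        Fintype.card Y * (S.card : ℝ) ^ 2 := by
  obtain ⟨n, hn⟩ : ∃ n : ℝ, n = S.card := ⟨_, rfl⟩
  obtain ⟨N, hN⟩ : ∃ N : ℝ, N = Fintype.card Y := ⟨_, rfl⟩
  obtain ⟨k, hk⟩ : ∃ k : Y → ℝ, k = fun y => ∑ x ∈ S, if f x = y then (1 : ℝ) else 0 := ⟨_, rfl⟩
  have hsum : ∑ y, k y = n := by
    rw [hk, sum_comm]; simp [hn]
  have hsq : ∑ x ∈ S, ∑ x' ∈ S, (if f x = f x' then (1 : ℝ) else 0) = ∑ y, k y ^ 2 := by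
    simp_rw [hk, sq, sum_mul_sum]
    conv_rhs => rw [sum_comm]
    refine sum_congr rfl fun x _ => ?_
    conv_rhs => rw [sum_comm]
    refine sum_congr rfl fun x' _ => ?_
    simp [eq_comm]
  have hzero : ∀ y ∈ (S.image f)ᶜ, k y = 0 := by
    intro y hy
    rw [hk]
    refine sum_eq_zero fun x hx => if_neg ?_
    rintro rfl
    exact mem_compl.1 hy (mem_image_of_mem f hx)
  rw [hsq, ← hn, ← hN]
  calc ((S.image f)ᶜ.card : ℝ) * n ^ 2 = ∑ y ∈ (S.image f)ᶜ, (N * k y - n) ^ 2 := by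
        rw [sum_congr rfl (fun y hy => by rw [hzero y hy]), sum_const, nsmul_eq_mul]
        ring
    _ ≤ ∑ y, (N * k y - n) ^ 2 :=
        sum_le_sum_of_subset_of_nonneg (subset_univ _) fun _ _ _ => sq_nonneg _
    _ = N ^ 2 * (∑ y, k y ^ 2) - 2 * N * n * (∑ y, k y) + N * n ^ 2 := by
        simp_rw [sub_sq, mul_pow]
        rw [sum_add_distrib, sum_sub_distrib, ← mul_sum, sum_const, card_univ, nsmul_eq_mul,
          ← hN, mul_sum (a := 2 * N * n)]
        congr 2
        exact sum_congr rfl fun y _ => by ring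
    _ = _ := by rw [hsum]; ring

theorem sum_collision {u b t : ℕ} {x x' : BinVec u} (h : x ≠ x') :
    (∑ P : LinMaps u b, ∑ Q : LinMaps u t,
      (if ((P x, Q x) : BinVec b × BinVec t) = (P x', Q x') then (1 : ℝ) else 0)) * 2 ^ (b + t) =
      Fintype.card (LinMaps u b) * Fintype.card (LinMaps u t) := by
  have h1 := card_annihilator_mul (b := b) (sub_ne_zero.2 h)
  have h2 := card_annihilator_mul (b := t) (sub_ne_zero.2 h)
  rw [← h1, ← h2, card_filter, card_filter]
  push_cast
  rw [pow_add, mul_mul_mul_comm, sum_mul_sum]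
  congr 1
  refine sum_congr rfl fun P _ => sum_congr rfl fun Q _ => ?_
  by_cases hP : P x = P x' <;> by_cases hQ : Q x = Q x' <;> simp [hP, hQ, sub_eq_zero]

/-- Distinct points collide with probability `1 / N`, so their share of the second moment is
cancelled by the subtracted term and only the diagonal remains. -/
theorem sum_card_compl_pairImage_mul_le {u b t : ℕ} (S : Finset (BinVec u)) :
    (∑ P : LinMaps u b, ∑ Q : LinMaps u t, ((pairImage P Q S)ᶜ.card : ℝ)) * S.card ≤
      Fintype.card (LinMaps u b) * Fintype.card (LinMaps u t) * (2 ^ (b + t)) ^ 2 := by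
  obtain ⟨n, hn⟩ : ∃ n : ℝ, n = S.card := ⟨_, rfl⟩
  obtain ⟨N, hN⟩ : ∃ N : ℝ, N = 2 ^ (b + t) := ⟨_, rfl⟩
  obtain ⟨A, hA⟩ : ∃ A : ℝ, A = Fintype.card (LinMaps u b) * Fintype.card (LinMaps u t) :=
    ⟨_, rfl⟩
  have hN0 : 0 < N := by rw [hN]; positivity
  have hA0 : 0 ≤ A := by rw [hA]; positivity
  have hn0 : 0 ≤ n := by rw [hn]; positivity
  rw [← hn, ← hN, ← hA]
  rcases hn0.eq_or_lt with h0 | hnpos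
  · rw [← h0, mul_zero]; positivity
  have hcoll : ∀ x ∈ S, ∑ x' ∈ S, (∑ P : LinMaps u b, ∑ Q : LinMaps u t,
      (if ((P x, Q x) : BinVec b × BinVec t) = (P x', Q x') then (1 : ℝ) else 0)) ≤
        A + n * (A / N) := by
    intro x hx
    rw [← add_sum_erase S _ hx]
    refine add_le_add ?_ ?_
    · simp [hA, card_univ]
    · have : ∀ x' ∈ S.erase x, (∑ P : LinMaps u b, ∑ Q : LinMaps u t,
          (if ((P x, Q x) : BinVec b × BinVec t) = (P x', Q x') then (1 : ℝ) else 0)) =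
            A / N := by
        intro x' hx'
        rw [eq_div_iff hN0.ne', hN, hA]
        exact sum_collision (ne_of_mem_erase hx').symm
      rw [sum_congr rfl this, sum_const, nsmul_eq_mul, hn]
      exact mul_le_mul_of_nonneg_right (by exact_mod_cast card_erase_le) (by positivity)
  have htot : ∑ P : LinMaps u b, ∑ Q : LinMaps u t, ∑ x ∈ S, ∑ x' ∈ S,
      (if ((P x, Q x) : BinVec b × BinVec t) = (P x', Q x') then (1 : ℝ) else 0) ≤
        n * (A + n * (A / N)) := by
    have hswap : ∑ P : LinMaps u b, ∑ Q : LinMaps u t, ∑ x ∈ S, ∑ x' ∈ S,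
        (if ((P x, Q x) : BinVec b × BinVec t) = (P x', Q x') then (1 : ℝ) else 0) =
        ∑ x ∈ S, ∑ x' ∈ S, ∑ P : LinMaps u b, ∑ Q : LinMaps u t,
        (if ((P x, Q x) : BinVec b × BinVec t) = (P x', Q x') then (1 : ℝ) else 0) := by
      simp_rw [← Fintype.sum_prod_type']
      rw [sum_comm]
      exact sum_congr rfl fun x _ => sum_comm
    rw [hswap]
    refine (sum_le_sum hcoll).trans ?_
    rw [sum_const, nsmul_eq_mul, hn]
  have hsum : (∑ P : LinMaps u b, ∑ Q : LinMaps u t, ((pairImage P Q S)ᶜ.card : ℝ)) * n ^ 2 ≤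
      N ^ 2 * (n * (A + n * (A / N))) - A * (N * n ^ 2) := by
    refine le_trans ?_ (sub_le_sub_right (mul_le_mul_of_nonneg_left htot (by positivity)) _)
    have hconst : A * (N * n ^ 2) = ∑ _P : LinMaps u b, ∑ _Q : LinMaps u t, N * n ^ 2 := by
      simp [hA, card_univ, mul_assoc]
    rw [hconst, sum_mul, mul_sum, ← sum_sub_distrib]
    refine sum_le_sum fun P _ => ?_
    rw [sum_mul, mul_sum, ← sum_sub_distrib]
    refine sum_le_sum fun Q _ => ?_
    have := card_compl_image_mul_sq_le (fun x => ((P x, Q x) : BinVec b × BinVec t)) S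
    rwa [card_binVec_prod, ← hn, ← hN] at this
  refine le_of_mul_le_mul_right ?_ hnpos
  calc _ = (∑ P : LinMaps u b, ∑ Q : LinMaps u t, ((pairImage P Q S)ᶜ.card : ℝ)) * n ^ 2 := by
        ring
    _ ≤ _ := hsum
    _ = A * N ^ 2 * n := by field_simp; ring

open Classical in
-- Below density `d` the exponent in `card_containsFiber_le` is at least `1`, by `b ≤ 2 ^ t` and `d
-- ≤ 1 / 4`, giving `d`. Above it the second summand exceeds `1`; it is linear in `B.card`, so it
-- can be averaged.
theorem card_containsFiber_le_markov {b t : ℕ} (hb : 1 ≤ b) (hbt : b ≤ 2 ^ t) {d : ℝ}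
    (hd0 : 0 < d) (hd : d ≤ 1 / 4) (B : Finset (BinVec b × BinVec t)) :
    ((univ.filter fun W : Fin t → BinVec b => ContainsFiber W B).card : ℝ) ≤
      2 ^ (b * t) * (d + B.card / (d * 2 ^ (b + t))) := by
  have hN : (0 : ℝ) < 2 ^ (b + t) := by positivity
  rcases le_total (B.card : ℝ) (d * 2 ^ (b + t)) with h | h
  · have h1 := card_containsFiber_le hb t B d hd0 (by linarith) h
    have hg : 2 ≤ -Real.logb 2 d := by
      have := Real.logb_le_logb_of_le one_lt_two hd0 hd
      rw [show (1 / 4 : ℝ) = (2 ^ 2)⁻¹ by norm_num, Real.logb_inv, Real.logb_pow,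
        Real.logb_self_eq_one one_lt_two] at this
      push_cast at this
      linarith
    have hgg : 1 ≤ Real.logb 2 (-Real.logb 2 d) := by
      rw [← Real.logb_self_eq_one one_lt_two]
      exact Real.logb_le_logb_of_le one_lt_two two_pos hg
    have hbt' : Real.logb 2 b ≤ t := by
      have h0 : (0 : ℝ) < b := by exact_mod_cast hb
      have h2 : (b : ℝ) ≤ 2 ^ t := by exact_mod_cast hbt
      have := Real.logb_le_logb_of_le one_lt_two h0 h2
      rwa [Real.logb_pow, Real.logb_self_eq_one one_lt_two, mul_one] at this
    have h2 : d ^ ((t : ℝ) - Real.logb 2 b + Real.logb 2 (-Real.logb 2 d)) ≤ d := by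
      conv_rhs => rw [← Real.rpow_one d]
      exact Real.rpow_le_rpow_of_exponent_ge hd0 (by linarith) (by linarith)
    have h3 : 0 ≤ (B.card : ℝ) / (d * 2 ^ (b + t)) := by positivity
    refine le_trans h1 (mul_le_mul_of_nonneg_left ?_ (by positivity))
    linarith
  · have h1 : 1 ≤ (B.card : ℝ) / (d * 2 ^ (b + t)) := (one_le_div (by positivity)).2 h
    have h2 : ((univ.filter fun W : Fin t → BinVec b => ContainsFiber W B).card : ℝ) ≤
        2 ^ (b * t) := by
      rw [← card_columns]; exact_mod_cast card_le_univ _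
    exact h2.trans (le_mul_of_one_le_right (by positivity) (by linarith))

theorem unifProb_not_cover_le {u b t : ℕ} (hb : 1 ≤ b) (hbt : b ≤ 2 ^ t) {d : ℝ} (hd0 : 0 < d)
    (hd : d ≤ 1 / 4) (S : Finset (BinVec u)) (hS : 0 < S.card) :
    unifProb {T : LinMaps u b | T '' (S : Set (BinVec u)) ≠ Set.univ} ≤
      d + 2 ^ (b + t) / (d * S.card) := by
  classical
  rw [unifProb_eq]
  have hL : (0 : ℝ) < Fintype.card (LinMaps u b) := by exact_mod_cast Fintype.card_pos
  have hM : (0 : ℝ) < Fintype.card (LinMaps u t) := by exact_mod_cast Fintype.card_pos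
  have hn : (0 : ℝ) < S.card := by exact_mod_cast hS
  rw [div_le_iff₀ hL]
  have hW : (0 : ℝ) < 2 ^ (b * t) := by positivity
  have hlower : ((univ.filter fun T => T ∈ {T : LinMaps u b |
      T '' (S : Set (BinVec u)) ≠ Set.univ}).card : ℝ) *
        (Fintype.card (LinMaps u t) * 2 ^ (b * t)) ≤
      ∑ T : LinMaps u b, ∑ Q : LinMaps u t, ((univ.filter fun W : Fin t → BinVec b =>
        ContainsFiber W (pairImage (T + (ofColumns W).comp Q) Q S)ᶜ).card : ℝ) := by
    rw [card_filter, Nat.cast_sum, sum_mul]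
    refine sum_le_sum fun T _ => ?_
    split_ifs with hT
    · have : ∀ Q : LinMaps u t, (univ.filter fun W : Fin t → BinVec b =>
          ContainsFiber W (pairImage (T + (ofColumns W).comp Q) Q S)ᶜ) = univ := fun Q =>
        filter_true_of_mem fun W _ => containsFiber_compl_pairImage T Q W S hT
      simp_rw [this, card_univ, card_columns]
      simp [card_univ]
    · rw [Nat.cast_zero, zero_mul]
      exact sum_nonneg fun Q _ => Nat.cast_nonneg _
  have hshift : (∑ T : LinMaps u b, ∑ Q : LinMaps u t, ((univ.filter fun W : Fin t → BinVec b =>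
      ContainsFiber W (pairImage (T + (ofColumns W).comp Q) Q S)ᶜ).card : ℝ)) =
      ∑ P : LinMaps u b, ∑ Q : LinMaps u t, ((univ.filter fun W : Fin t → BinVec b =>
        ContainsFiber W (pairImage P Q S)ᶜ).card : ℝ) := by
    exact_mod_cast sum_sum_sum_containsFiber (fun (P : LinMaps u b) (Q : LinMaps u t) =>
      (pairImage P Q S)ᶜ)
  obtain ⟨U, hU⟩ : ∃ U : ℝ, U = ∑ P : LinMaps u b, ∑ Q : LinMaps u t,
    ((pairImage P Q S)ᶜ.card : ℝ) := ⟨_, rfl⟩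
  have hupper : ∑ P : LinMaps u b, ∑ Q : LinMaps u t, ((univ.filter fun W : Fin t → BinVec b =>
      ContainsFiber W (pairImage P Q S)ᶜ).card : ℝ) ≤
      2 ^ (b * t) * (Fintype.card (LinMaps u b) * Fintype.card (LinMaps u t) * d +
        U / (d * 2 ^ (b + t))) := by
    calc _ ≤ ∑ P : LinMaps u b, ∑ Q : LinMaps u t,
          2 ^ (b * t) * (d + ((pairImage P Q S)ᶜ.card : ℝ) / (d * 2 ^ (b + t))) :=
          sum_le_sum fun P _ => sum_le_sum fun Q _ =>
            card_containsFiber_le_markov hb hbt hd0 hd _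
      _ = _ := by
        simp_rw [← mul_sum, sum_add_distrib, ← sum_div, ← hU]
        simp [card_univ, mul_assoc]
  have hUle : U ≤ Fintype.card (LinMaps u b) * Fintype.card (LinMaps u t) *
      (2 ^ (b + t)) ^ 2 / S.card := by
    rw [le_div_iff₀ hn, hU]; exact sum_card_compl_pairImage_mul_le S
  refine le_of_mul_le_mul_right ?_ (mul_pos hM hW)
  refine (hlower.trans_eq hshift).trans (hupper.trans ?_)
  calc _ ≤ 2 ^ (b * t) * (Fintype.card (LinMaps u b) * Fintype.card (LinMaps u t) * d +
        (Fintype.card (LinMaps u b) * Fintype.card (LinMaps u t) *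
      (2 ^ (b + t)) ^ 2 / S.card) / (d * 2 ^ (b + t))) := by gcongr
    _ = _ := by field_simp

theorem unifProb_compl {Ω : Type} [Finite Ω] [Nonempty Ω] (E : Set Ω) :
    unifProb E = 1 - unifProb Eᶜ := by
  have h : (E.ncard : ℝ) + Eᶜ.ncard = Nat.card Ω := by exact_mod_cast Set.ncard_add_ncard_compl E
  have h0 : (0 : ℝ) < Nat.card Ω := by exact_mod_cast Nat.card_pos
  rw [unifProb, unifProb, eq_sub_iff_add_eq, ← add_div, h, div_self h0.ne']

theorem isCoveringConst_of_sixteen_div_sq {ε : ℝ} (hε0 : 0 < ε) (hε1 : ε < 1) :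
    IsCoveringConst ε (16 / ε ^ 2) := by
  intro u t ht S hS
  have ht0 : (0 : ℝ) < t := by exact_mod_cast ht
  have hpos : 0 < 16 / ε ^ 2 * t * 2 ^ t := by positivity
  have hn : (0 : ℝ) < S.card := hpos.trans_le hS
  -- The auxiliary dimension is `Nat.log 2 t + 1`: large enough for the fiber bound, yet enlarging
  -- the space by a factor of at most `2 * t`. With `d = ε / 4` the failure probability is at most
  -- `ε / 4 + ε / 2`.
  have hlt : t ≤ 2 ^ (Nat.log 2 t + 1) := (Nat.lt_pow_succ_log_self one_lt_two t).le
  have hle : (2 : ℝ) ^ (Nat.log 2 t + 1) ≤ 2 * t := by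
    rw [pow_succ, mul_comm]
    exact mul_le_mul_of_nonneg_left
      (by exact_mod_cast Nat.pow_log_le_self 2 (by omega)) two_pos.le
  have h := unifProb_not_cover_le ht hlt (by positivity : 0 < ε / 4) (by linarith) S
    (by exact_mod_cast hn)
  rw [unifProb_compl]
  have h2 : (2 : ℝ) ^ (t + (Nat.log 2 t + 1)) / (ε / 4 * S.card) ≤ ε / 2 := by
    rw [div_le_iff₀ (by positivity), pow_add]
    calc (2 : ℝ) ^ t * 2 ^ (Nat.log 2 t + 1) ≤ 2 ^ t * (2 * t) := by gcongr
      _ = ε / 2 * (ε / 4 * (16 / ε ^ 2 * t * 2 ^ t)) := by field_simp; ring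
      _ ≤ _ := by gcongr
  have h3 : unifProb {T : LinMaps u t | T '' (S : Set (BinVec u)) = Set.univ}ᶜ ≤ ε := by
    refine le_trans h ?_
    linarith
  linarith

theorem theorem2 (ε : ℝ) (hε0 : 0 < ε) (hε1 : ε < 1) :
    (∃ c : ℝ, 0 < c ∧ IsCoveringConst ε c ∧ TailBound ε c) ∧
    (∀ c : ℝ, 0 < c → IsCoveringConst ε c → TailBound ε c) := by
  have hcov := isCoveringConst_of_sixteen_div_sq hε0 hε1
  have hpos : 0 < 16 / ε ^ 2 := by positivity
  exact ⟨⟨_, hpos, hcov, tailBound_of_isCoveringConst hε1 hpos hcov⟩,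
    fun c hc h => tailBound_of_isCoveringConst hε1 hc h⟩
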